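/- **Lemma (Surjective Lemma).** All rings have a $1$ and all modules are unital. Let $R$ be a commutative ring, let $S$ be a (not necessarily commutative) $R$-algebra that is finitely generated as an $R$-module, let $M$ be a right $S$-module, and let $N$ be a finitely generated right $S$-module; regard $M$ and $N$ as $R$-modules in the natural way, so that $\operatorname{Hom}_S(M,N)$ is an $R$-module. Give every subset of $\operatorname{Spec}(R)$ the subspace topology of the Zariski topology. For $X\subseteq\operatorname{Spec}(R)$ and $\mathfrak p\in X$, let $\dim_X(\mathfrak p)\in\{0,1,2,\ldots,\infty\}$ be the Krull dimension of the topological space $\{\mathfrak q\in X:\mathfrak p\subseteq\mathfrak q\}$. Call $X$ a *basic set for $R$* if $X$ is a Noetherian space and every $\mathfrak p\in\operatorname{Spec}(R)$ that is an intersection of members of $X$ belongs to $X$. For an $R$-submodule $F$ of $\operatorname{Hom}_S(M,N)$ and $\mathfrak p\in\operatorname{Spec}(R)$, let $\partial_{\mathfrak p}(F)\in\{0,1,2,\ldots,\infty\}$ be the supremum of the integers $d\geq 0$ for which there exist $g_1,\ldots,g_d\in F$ such that the localization $g_{\mathfrak p}:M_{\mathfrak p}\to (N^{\oplus d})_{\mathfrak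 p}$ of $g=(g_1,\ldots,g_d)^{\top}:M\to N^{\oplus d}$ is surjective. For positive integers $m\geq t$, a column $g=(g_1,\ldots,g_m)^{\top}\in\operatorname{Hom}_S(M,N^{\oplus m})$ is *$(t,X,X)$-surjective* if $$\partial_{\mathfrak p}(Rg_1+\cdots+Rg_m)\;\geq\;\min\{m,\;t+\dim_X(\mathfrak p)\}\qquad\text{for every }\mathfrak p\in X.$$ Let $n,t$ be positive integers with $n\geq t+1$, let $X\subseteq\operatorname{Supp}_R(N)$ be a basic set for $R$, and let $f=(f_1,\ldots,f_n)^{\top}\in\operatorname{Hom}_S(M,N^{\oplus n})$ be $(t,X,X)$-surjective. Then there exist $f'_1,\ldots,f'_{n-1}\in Rf_1+\cdots+Rf_n$ such that $f'=(f'_1,\ldots,f'_{n-1})^{\top}$ is $(t,X,X)$-surjective. -/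

import Mathlib

namespace SurjLemma

section Spectrum

variable {R : Type*} [CommRing R]

/-- `dim_X(p)`: the Krull dimension of the subspace `Var(p) ∩ X` of `Spec(R)`, where `Var(p)` is
the set of primes containing `p`. -/
noncomputable def dimAt (X : Set (PrimeSpectrum R)) (p : PrimeSpectrum R) : WithBot ℕ∞ :=
  topologicalKrullDim ↥({q : PrimeSpectrum R | p.asIdeal ≤ q.asIdeal} ∩ X)

/-- `X ⊆ Spec(R)` is a basic set for `R`: it is a Noetherian space, and every prime that is an
intersection of members of `X` belongs to `X`. -/
structure IsBasicSet (X : Set (PrimeSpectrum R)) : Prop where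
  noetherian : TopologicalSpace.NoetherianSpace ↥X
  mem_of_eq_iInf : ∀ p : PrimeSpectrum R,
    (∃ Z ⊆ X, p.asIdeal = ⨅ q ∈ Z, q.asIdeal) → p ∈ X

end Spectrum

section Modules

/- Right `S`-modules are modules over `Sᵐᵒᵖ`; the scalar tower says that the `R`-module structure
is the one induced from the `S`-module structure. -/
variable {R S M N : Type*} [CommRing R] [Ring S] [Algebra R S]
  [AddCommGroup M] [Module R M] [Module Sᵐᵒᵖ M] [IsScalarTower R Sᵐᵒᵖ M]
  [AddCommGroup N] [Module R N] [Module Sᵐᵒᵖ N] [IsScalarTower R Sᵐᵒᵖ N]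

/-- The localization at `p` of the column `(g_1, …, g_d)ᵀ : M → N^d` is surjective.  (The
localization of a right `S`-module at `p` is its localization as an `R`-module.) -/
def LocSurjective (p : PrimeSpectrum R) {d : ℕ} (g : Fin d → (M →ₗ[Sᵐᵒᵖ] N)) : Prop :=
  Function.Surjective
    (LocalizedModule.map p.asIdeal.primeCompl ((LinearMap.pi g).restrictScalars R))

/-- `∂_p(F)`: the supremum of the nonnegative integers `d` such that some column with `d` entries
in `F` becomes surjective after localization at `p`. -/
noncomputable def partialAt (p : PrimeSpectrum R) (F : Submodule R (M →ₗ[Sᵐᵒᵖ] N)) : ℕ∞ :=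
  ⨆ d ∈ {d : ℕ | ∃ g : Fin d → (M →ₗ[Sᵐᵒᵖ] N), (∀ i, g i ∈ F) ∧ LocSurjective p g}, (d : ℕ∞)

/-- `f = (f_1, …, f_n)ᵀ` is `(t, X, p)`-surjective. -/
def IsSurjectiveAt (t : ℕ) (X : Set (PrimeSpectrum R)) (p : PrimeSpectrum R) {n : ℕ}
    (f : Fin n → (M →ₗ[Sᵐᵒᵖ] N)) : Prop :=
  min (n : WithBot ℕ∞) ((t : WithBot ℕ∞) + dimAt X p) ≤
    (partialAt p (Submodule.span R (Set.range f)) : WithBot ℕ∞)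

/-- `f = (f_1, …, f_n)ᵀ` is `(t, X, Y)`-surjective. -/
def IsSurjectiveOn (t : ℕ) (X Y : Set (PrimeSpectrum R)) {n : ℕ}
    (f : Fin n → (M →ₗ[Sᵐᵒᵖ] N)) : Prop :=
  ∀ q ∈ Y, IsSurjectiveAt t X q f

end Modules

end SurjLemma

/-! Let F be the R-span of f. By Nakayama, `partialAt p F` can be computed on the fibre over the
residue field κ(p), and the loci C_k where it is at most k are closed.

Replacing f by a generating family of F of the same length and omitting its last member lowers the
invariant by at most one at any prime. This is harmless at p if the value there is at least n (n
being the new length), or if the inequality at p has one unit to spare. Let the value at p be k. If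
p is not minimal in X ∩ C_k, some q < p in X has value at most k. Then t + dim_X(q) ≤ k if k does
not exceed the new length, and `dimAt_add_one_le` gives t + dim_X(p) + 1 ≤ k: a unit to spare.

Only the minimal members of the X ∩ C_k remain. There are finitely many of them
(`IsBasicSet.finite_minimal`), and there nothing may be lost below the new length.
`exists_span_eq_and_le_partialAt` treats finitely many primes one at a time: elementary operations
with coefficients divisible by an s outside p but inside the primes already treated leave the fibres
at those primes unchanged. On one fibre, the operation exists by linear algebra
(`HasSurjection.exists_elementary`). -/

namespace SurjLemma

/-! ### Jointly surjective linear maps over a field -/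

section LinearAlgebra

variable {κ A B C : Type*} [Field κ] [AddCommGroup A] [Module κ A] [AddCommGroup B] [Module κ B]
  [AddCommGroup C] [Module κ C]

/-- Some `d` members of `U` are jointly surjective, that is, they form a surjection `A → B ^ d`. -/
def HasSurjection (U : Submodule κ (A →ₗ[κ] B)) (d : ℕ) : Prop :=
  ∃ g : Fin d → (A →ₗ[κ] B), (∀ i, g i ∈ U) ∧ Function.Surjective (LinearMap.pi g)

/-- `κ` consists of fractions of elements of the image of `R`. -/
def IsFractionFieldOfImage (R κ : Type*) [CommRing R] [Field κ] [Algebra R κ] : Prop :=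
  ∀ x : κ, ∃ a b : R, algebraMap R κ b ≠ 0 ∧ algebraMap R κ b * x = algebraMap R κ a

theorem IsFractionFieldOfImage.exists_common_denominator {R : Type*} [CommRing R] [Algebra R κ]
    (h : IsFractionFieldOfImage R κ) {n : ℕ} (x : Fin n → κ) :
    ∃ (d : R) (y : Fin n → R), algebraMap R κ d ≠ 0 ∧
      ∀ i, algebraMap R κ d * x i = algebraMap R κ (y i) := by
  classical
  choose a b hb hab using fun i => h (x i)
  refine ⟨∏ i, b i, fun i => (∏ j ∈ Finset.univ.erase i, b j) * a i, ?_, fun i => ?_⟩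
  · rw [map_prod]
    exact Finset.prod_ne_zero_iff.2 fun i _ => hb i
  · rw [← Finset.prod_erase_mul _ _ (Finset.mem_univ i), map_mul, map_mul, mul_assoc, hab]

/-- A finite domain is a field, so the image of R already contains its own fractions. -/
theorem IsFractionFieldOfImage.surjective_of_finite {R : Type*} [CommRing R] [Algebra R κ]
    (h : IsFractionFieldOfImage R κ) (hfin : (Set.range (algebraMap R κ)).Finite) :
    Function.Surjective (algebraMap R κ) := by
  intro x
  obtain ⟨a, b, hb, hab⟩ := h x
  have : Finite (algebraMap R κ).range := hfin
  have hF := Finite.isField_of_domain (algebraMap R κ).range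
  obtain ⟨⟨_, c, rfl⟩, hc⟩ := hF.mul_inv_cancel (a := ⟨algebraMap R κ b, b, rfl⟩)
    (fun h0 => hb (congrArg Subtype.val h0))
  have hc' : algebraMap R κ b * algebraMap R κ c = 1 := congrArg Subtype.val hc
  refine ⟨c * a, ?_⟩
  rw [map_mul, ← hab, ← mul_assoc, mul_comm (algebraMap R κ c), hc', one_mul]

/-- A pencil of linear maps that has a surjective member over the field has one with parameter
in `R`. -/
theorem IsFractionFieldOfImage.exists_surjective_add_smul {R : Type*} [CommRing R] [Algebra R κ]
    (h : IsFractionFieldOfImage R κ) [FiniteDimensional κ C] (g₀ g₁ : A →ₗ[κ] C) (x : κ)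
    (hx : Function.Surjective (g₀ + x • g₁)) :
    ∃ a : R, Function.Surjective (g₀ + algebraMap R κ a • g₁) := by
  by_cases hfin : (Set.range (algebraMap R κ)).Finite
  · obtain ⟨a, rfl⟩ := h.surjective_of_finite hfin x
    exact ⟨a, hx⟩
  obtain ⟨σ, hσ⟩ := LinearMap.exists_rightInverse_of_surjective _ (LinearMap.range_eq_top.2 hx)
  -- For every y, (g₀ + y g₁)σ = 1 + (y − x)u. For y ≠ x this is invertible unless −(y − x)⁻¹ is an
  -- eigenvalue of u, which excludes only finitely many y.
  let u : Module.End κ C := g₁ ∘ₗ σ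
  have hbad : ((fun y : κ => -(y - x)⁻¹) ⁻¹' spectrum κ u).Finite :=
    Set.Finite.preimage (fun y _ z _ hyz => by simpa using hyz) (Module.End.finite_spectrum u)
  obtain ⟨y, ⟨a, rfl⟩, ha⟩ := (Set.Infinite.sdiff hfin (hbad.union (Set.finite_singleton x))).nonempty
  refine ⟨a, ?_⟩
  simp only [Set.mem_union, Set.mem_preimage, Set.mem_singleton_iff, not_or] at ha
  obtain ⟨ha, hax⟩ := ha
  have hax' : algebraMap R κ a - x ≠ 0 := sub_ne_zero.2 hax
  have hunit := spectrum.notMem_iff.1 ha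
  have hsurj := ((Module.End.isUnit_iff _).1 hunit).2
  intro c
  obtain ⟨w, hw⟩ := hsurj (-(algebraMap R κ a - x)⁻¹ • c)
  refine ⟨σ w, ?_⟩
  have h1 : g₀ (σ w) + x • g₁ (σ w) = w := LinearMap.congr_fun hσ w
  have hw' : -(algebraMap R κ a - x)⁻¹ • w - g₁ (σ w) = -(algebraMap R κ a - x)⁻¹ • c := by
    simpa [u, Module.algebraMap_end_apply] using hw
  have h2 := congrArg (fun z => -(algebraMap R κ a - x) • z) hw'
  simp only [smul_sub, smul_smul, neg_mul_neg, mul_inv_cancel₀ hax', one_smul] at h2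
  have h3 : g₀ (σ w) = w - x • g₁ (σ w) := eq_sub_of_add_eq h1
  rw [LinearMap.add_apply, LinearMap.smul_apply, h3, ← h2]
  module

theorem HasSurjection.mono {U W : Submodule κ (A →ₗ[κ] B)} (hUW : U ≤ W) {d e : ℕ} (hed : e ≤ d)
    (h : HasSurjection U d) : HasSurjection W e := by
  obtain ⟨g, hgU, hg⟩ := h
  refine ⟨fun i => g (Fin.castLE hed i), fun i => hUW (hgU _), fun y => ?_⟩
  obtain ⟨x, hx⟩ := hg (fun i => if hi : i.1 < e then y ⟨i, hi⟩ else 0)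
  refine ⟨x, funext fun i => ?_⟩
  have := congrFun hx (Fin.castLE hed i)
  simpa using this

theorem HasSurjection.zero (U : Submodule κ (A →ₗ[κ] B)) : HasSurjection U 0 :=
  ⟨Fin.elim0, fun i => i.elim0, fun _ => ⟨0, Subsingleton.elim _ _⟩⟩

/-- Passing to a subspace of corank one costs at most one copy of the target. -/
theorem HasSurjection.of_corank_one {U W : Submodule κ (A →ₗ[κ] B)} (v : A →ₗ[κ] B)
    (hUW : ∀ g ∈ U, ∃ a : κ, ∃ w ∈ W, w + a • v = g) {d : ℕ} (h : HasSurjection U (d + 1)) :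
    HasSurjection W d := by
  obtain ⟨g, hgU, hg⟩ := h
  choose a w hw hwg using fun i => hUW (g i) (hgU i)
  have ha : ∀ i, g i - a i • v ∈ W := fun i => by
    rw [← hwg i, add_sub_cancel_right]
    exact hw i
  by_cases h0 : ∀ i, a i = 0
  · have hW : HasSurjection W (d + 1) := ⟨g, fun i => by simpa [h0] using ha i, hg⟩
    exact hW.mono le_rfl d.le_succ
  push Not at h0
  obtain ⟨j, hj⟩ := h0
  -- Use g j as a pivot to clear the coefficients of v. Prescribing the value 0 for g j shows that
  -- the remaining d maps stay jointly surjective.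
  refine ⟨fun i => g (j.succAbove i) - (a (j.succAbove i) * (a j)⁻¹) • g j, fun i => ?_,
    fun y => ?_⟩
  · have := W.sub_mem (ha (j.succAbove i)) (W.smul_mem (a (j.succAbove i) * (a j)⁻¹) (ha j))
    convert this using 1
    rw [smul_sub, smul_smul, inv_mul_cancel_right₀ hj]
    module
  · obtain ⟨x, hx⟩ := hg (j.insertNth 0 y)
    refine ⟨x, funext fun i => ?_⟩
    have h1 : g j x = 0 := by simpa using congrFun hx j
    have h2 : g (j.succAbove i) x = y i := by simpa using congrFun hx (j.succAbove i)
    simp [h1, h2]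

/-- A vector `e_n + σ ∑ c_i e_i` outside the span of fewer than `n + 1` vectors, together with a
linear form that detects it. -/
theorem exists_linearForm_eq_one {R : Type*} [CommRing R] [Algebra R κ] {n k : ℕ} (hk : k ≤ n)
    (b : Fin k → Fin (n + 1) → κ) {σ : κ} (hσ : σ ≠ 0) :
    ∃ (c : Fin n → R) (m : Fin (n + 1) → κ), (∀ j, ∑ i, b j i * m i = 0) ∧
      m (Fin.last n) + ∑ i, σ * algebraMap R κ (c i) * m i.castSucc = 1 := by
  classical
  have hlt : Submodule.span κ (Set.range b) < ⊤ := by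
    refine lt_top_iff_ne_top.2 fun h => ?_
    have h1 := finrank_range_le_card (R := κ) b
    rw [Set.finrank, h, finrank_top, Module.finrank_fin_fun, Fintype.card_fin] at h1
    omega
  obtain ⟨l, hl0, hl⟩ := Submodule.exists_le_ker_of_lt_top _ hlt
  let m : Fin (n + 1) → κ := fun i => l (Pi.single i 1)
  have hlm : ∀ w, l w = ∑ i, w i * m i := fun w => by
    conv_lhs => rw [pi_eq_sum_univ' w, map_sum]
    refine Finset.sum_congr rfl fun i _ => ?_
    rw [map_smul, smul_eq_mul]
  have hm : ∃ i, m i ≠ 0 := by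
    by_contra! h
    exact hl0 (LinearMap.ext fun w => by simp [hlm, h])
  have hbm : ∀ j, ∑ i, b j i * m i = 0 := fun j => by
    rw [← hlm]
    exact hl (Submodule.subset_span ⟨j, rfl⟩)
  obtain ⟨c, hc⟩ : ∃ c : Fin n → R,
      m (Fin.last n) + ∑ i, σ * algebraMap R κ (c i) * m i.castSucc ≠ 0 := by
    -- If m does not vanish on the last basis vector, c = 0 suffices; otherwise add σ times another
    -- basis vector on which it does not vanish.
    by_cases hlast : m (Fin.last n) = 0
    · obtain ⟨i, hi⟩ := hm
      induction i using Fin.lastCases with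
      | last => exact absurd hlast hi
      | cast i =>
        refine ⟨Pi.single i 1, ?_⟩
        rw [hlast, zero_add, Finset.sum_eq_single i]
        · simpa using ⟨hσ, hi⟩
        · intro j _ hj
          simp [Pi.single_eq_of_ne hj]
        · simp
    · exact ⟨0, by simpa using hlast⟩
  set q := m (Fin.last n) + ∑ i, σ * algebraMap R κ (c i) * m i.castSucc with hq
  refine ⟨c, fun i => q⁻¹ * m i, fun j => ?_, ?_⟩
  · simp_rw [mul_left_comm _ q⁻¹]
    rw [← Finset.mul_sum, hbm, mul_zero]
  · simp_rw [mul_left_comm _ q⁻¹]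
    rw [← Finset.mul_sum, ← mul_add, ← hq, inv_mul_cancel₀ hc]

/-- If a family of `n + 1` maps spans `k ≤ n` jointly surjective ones, then two elementary
operations with coefficients in `s R` make this true of its first `n` members. -/
theorem HasSurjection.exists_elementary {R : Type*} [CommRing R] [Algebra R κ]
    (hR : IsFractionFieldOfImage R κ) [FiniteDimensional κ B] {n k : ℕ} (hk : k ≤ n)
    (f : Fin (n + 1) → (A →ₗ[κ] B)) (h : HasSurjection (Submodule.span κ (Set.range f)) k)
    (s : R) (hs : algebraMap R κ s ≠ 0) :
    ∃ c r : Fin n → R, HasSurjection (Submodule.span κ (Set.range fun i : Fin n =>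
      f i.castSucc + algebraMap R κ (s * r i) •
        (f (Fin.last n) + ∑ j, algebraMap R κ (s * c j) • f j.castSucc))) k := by
  obtain ⟨g, hgf, hg⟩ := h
  choose b hb using fun j => (Submodule.mem_span_range_iff_exists_fun κ).1 (hgf j)
  obtain ⟨c, m, hbm, hm⟩ := exists_linearForm_eq_one (R := R) hk b hs
  obtain ⟨d, y, hd, hy⟩ := hR.exists_common_denominator (fun i : Fin n => -m i.castSucc)
  set v := f (Fin.last n) + ∑ j, algebraMap R κ (s * c j) • f j.castSucc with hv
  -- Coefficients of g j after the last generator is replaced by v.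
  let b' : Fin k → Fin n → κ := fun j i =>
    b j i.castSucc - b j (Fin.last n) * algebraMap R κ (s * c i)
  have hg' : ∀ j, g j = ∑ i, b' j i • f i.castSucc + b j (Fin.last n) • v := fun j => by
    rw [← hb j, Fin.sum_univ_castSucc, hv, smul_add, Finset.smul_sum]
    simp only [b', sub_smul, mul_smul, Finset.sum_sub_distrib]
    abel
  -- Since m kills the rows of b and is 1 on v, g j is the combination of the f i − m i • v with
  -- coefficients b' j i.
  have hb'm : ∀ j, ∑ i, b' j i * -m i.castSucc = b j (Fin.last n) := fun j => by
    have h1 := hbm j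
    rw [Fin.sum_univ_castSucc] at h1
    have h2 : ∑ i, b j (Fin.last n) * algebraMap R κ (s * c i) * m i.castSucc =
        b j (Fin.last n) * (1 - m (Fin.last n)) := by
      rw [← hm, add_sub_cancel_left, Finset.mul_sum]
      exact Finset.sum_congr rfl fun i _ => by rw [map_mul]; ring
    simp only [b', mul_neg, sub_mul, Finset.sum_neg_distrib, Finset.sum_sub_distrib, h2]
    linear_combination -h1
  let G₀ : A →ₗ[κ] (Fin k → B) := LinearMap.pi fun j => ∑ i, b' j i • f i.castSucc
  let G₁ : A →ₗ[κ] (Fin k → B) :=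
    LinearMap.pi fun j => (∑ i, b' j i * algebraMap R κ (s * y i)) • v
  -- At the parameter 1/(sd) the pencil is g itself. That parameter need not come from R, so it is
  -- then exchanged for some a in R.
  have hsurj : Function.Surjective
      (G₀ + ((algebraMap R κ s)⁻¹ * (algebraMap R κ d)⁻¹) • G₁) := by
    convert hg using 2
    ext x j
    have h3 : (algebraMap R κ s)⁻¹ * (algebraMap R κ d)⁻¹ *
        ∑ i, b' j i * algebraMap R κ (s * y i) = b j (Fin.last n) := by
      rw [← hb'm j, Finset.mul_sum]
      refine Finset.sum_congr rfl fun i _ => ?_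
      rw [map_mul, ← hy]
      field_simp
    simp only [G₀, G₁, LinearMap.add_apply, LinearMap.smul_apply, LinearMap.pi_apply,
      Pi.add_apply, Pi.smul_apply, smul_smul, h3, hg' j]
  obtain ⟨a, ha⟩ := hR.exists_surjective_add_smul G₀ G₁ _ hsurj
  refine ⟨c, fun i => a * y i, fun j => ∑ i, b' j i • (f i.castSucc +
    algebraMap R κ (s * (a * y i)) • v), fun j => Submodule.sum_mem _ fun i _ =>
      Submodule.smul_mem _ _ (Submodule.subset_span ⟨i, rfl⟩), ?_⟩
  convert ha using 2
  ext x j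
  simp only [G₀, G₁, LinearMap.add_apply, LinearMap.smul_apply, LinearMap.pi_apply,
      Pi.add_apply, Pi.smul_apply, smul_smul, LinearMap.sum_apply, smul_add,
      Finset.sum_add_distrib, ← Finset.sum_smul, Finset.mul_sum]
  congr 2
  refine Finset.sum_congr rfl fun i _ => ?_
  simp only [map_mul]
  ring

end LinearAlgebra

open TensorProduct

/-! ### Surjectivity on localizations and on fibres -/

section ExactSequences

variable {R M N : Type*} [CommRing R] [AddCommGroup M] [Module R M] [AddCommGroup N] [Module R N]

theorem surjective_iff_subsingleton_of_exact {A B C : Type*} [Zero C] {a : A → B} {b : B → C}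
    (hab : Function.Exact a b) (hb : Function.Surjective b) :
    Function.Surjective a ↔ Subsingleton C := by
  constructor
  · intro ha
    refine subsingleton_of_forall_eq 0 fun c => ?_
    obtain ⟨y, rfl⟩ := hb c
    exact (hab y).2 (ha y)
  · intro hC y
    exact (hab y).1 (Subsingleton.elim _ _)

theorem localizedModule_map_surjective_iff (p : PrimeSpectrum R) (h : M →ₗ[R] N) :
    Function.Surjective (LocalizedModule.map p.asIdeal.primeCompl h) ↔
      p ∉ Module.support R (N ⧸ LinearMap.range h) := by
  have hex : Function.Exact h (LinearMap.range h).mkQ := LinearMap.exact_map_mkQ_range h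
  rw [Module.notMem_support_iff]
  exact surjective_iff_subsingleton_of_exact
    (LocalizedModule.map_exact p.asIdeal.primeCompl _ _ hex)
    (LocalizedModule.map_surjective p.asIdeal.primeCompl _ (Submodule.mkQ_surjective _))

/-- Nakayama: the cokernel is finitely generated, so its fibre at p vanishes exactly when its
localization does. -/
theorem baseChange_residueField_surjective_iff [Module.Finite R N] (p : PrimeSpectrum R)
    (h : M →ₗ[R] N) :
    Function.Surjective (h.baseChange p.asIdeal.ResidueField) ↔
      p ∉ Module.support R (N ⧸ LinearMap.range h) := by
  have hex : Function.Exact h (LinearMap.range h).mkQ := LinearMap.exact_map_mkQ_range h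
  rw [Module.mem_support_iff_nontrivial_residueField_tensorProduct, not_nontrivial_iff_subsingleton]
  exact surjective_iff_subsingleton_of_exact
    (lTensor_exact p.asIdeal.ResidueField hex (Submodule.mkQ_surjective _))
    (LinearMap.lTensor_surjective p.asIdeal.ResidueField (Submodule.mkQ_surjective _))

end ExactSequences

theorem isFractionFieldOfImage_residueField {R : Type*} [CommRing R] (p : PrimeSpectrum R) :
    IsFractionFieldOfImage R p.asIdeal.ResidueField := by
  intro x
  obtain ⟨a, b, hb, rfl⟩ := IsFractionRing.div_surjective (A := R ⧸ p.asIdeal) x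
  obtain ⟨a, rfl⟩ := Ideal.Quotient.mk_surjective a
  obtain ⟨b, rfl⟩ := Ideal.Quotient.mk_surjective b
  have hb' : algebraMap R p.asIdeal.ResidueField b ≠ 0 := by
    rw [Ne, Ideal.algebraMap_residueField_eq_zero, ← Ideal.Quotient.eq_zero_iff_mem]
    exact nonZeroDivisors.ne_zero hb
  refine ⟨a, b, hb', ?_⟩
  rw [Ideal.algebraMap_quotient_residueField_mk, Ideal.algebraMap_quotient_residueField_mk,
    mul_div_cancel₀ _ hb']

/-! ### The invariant `partialAt` read on fibres, and its semicontinuity -/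

section Modules

variable {R S M N : Type*} [CommRing R] [Ring S] [Algebra R S]
  [AddCommGroup M] [Module R M] [Module Sᵐᵒᵖ M] [IsScalarTower R Sᵐᵒᵖ M]
  [AddCommGroup N] [Module R N] [Module Sᵐᵒᵖ N] [IsScalarTower R Sᵐᵒᵖ N]

/-- The map induced on the fibres over `p` by a homomorphism. -/
noncomputable def residueMap (p : PrimeSpectrum R) :
    (M →ₗ[Sᵐᵒᵖ] N) →ₗ[R]
      (p.asIdeal.ResidueField ⊗[R] M →ₗ[p.asIdeal.ResidueField] p.asIdeal.ResidueField ⊗[R] N) :=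
  LinearMap.baseChangeHom R p.asIdeal.ResidueField M N ∘ₗ LinearMap.restrictScalarsₗ R Sᵐᵒᵖ M N R

theorem residueMap_apply (p : PrimeSpectrum R) (g : M →ₗ[Sᵐᵒᵖ] N) :
    residueMap p g = (g.restrictScalars R).baseChange p.asIdeal.ResidueField := rfl

theorem locSurjective_iff_surjective_residueMap [Module.Finite R N] (p : PrimeSpectrum R) {d : ℕ}
    (g : Fin d → (M →ₗ[Sᵐᵒᵖ] N)) :
    LocSurjective p g ↔ Function.Surjective (LinearMap.pi fun i => residueMap p (g i)) := by
  rw [LocSurjective, localizedModule_map_surjective_iff, ← baseChange_residueField_surjective_iff]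
  let e := TensorProduct.piRight R p.asIdeal.ResidueField p.asIdeal.ResidueField
    (fun _ : Fin d => N)
  have he : (LinearMap.pi fun i => residueMap p (g i)) = e.toLinearMap ∘ₗ
      ((LinearMap.pi g).restrictScalars R).baseChange p.asIdeal.ResidueField := by
    ext x i
    simp [e, residueMap_apply]
  rw [he, LinearMap.coe_comp, LinearEquiv.coe_coe, EquivLike.comp_surjective]

theorem isOpen_setOf_locSurjective [Module.Finite R N] {d : ℕ} (g : Fin d → (M →ₗ[Sᵐᵒᵖ] N)) :
    IsOpen {p : PrimeSpectrum R | LocSurjective p g} := by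
  simp only [LocSurjective, localizedModule_map_surjective_iff]
  exact (Module.isClosed_support (R := R)
    (M := (Fin d → N) ⧸ LinearMap.range ((LinearMap.pi g).restrictScalars R))).isOpen_compl

/-- The fibre over `p` of a module of homomorphisms. -/
noncomputable def residueSpan (p : PrimeSpectrum R) (F : Submodule R (M →ₗ[Sᵐᵒᵖ] N)) :
    Submodule p.asIdeal.ResidueField
      (p.asIdeal.ResidueField ⊗[R] M →ₗ[p.asIdeal.ResidueField] p.asIdeal.ResidueField ⊗[R] N) :=
  Submodule.span p.asIdeal.ResidueField (residueMap p '' (F : Set (M →ₗ[Sᵐᵒᵖ] N)))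

theorem exists_smul_eq_residueMap (p : PrimeSpectrum R) {F : Submodule R (M →ₗ[Sᵐᵒᵖ] N)}
    {u : p.asIdeal.ResidueField ⊗[R] M →ₗ[p.asIdeal.ResidueField] p.asIdeal.ResidueField ⊗[R] N}
    (hu : u ∈ residueSpan p F) :
    ∃ s : R, algebraMap R p.asIdeal.ResidueField s ≠ 0 ∧
      ∃ g ∈ F, algebraMap R p.asIdeal.ResidueField s • u = residueMap p g := by
  induction hu using Submodule.span_induction with
  | mem x hx =>
    obtain ⟨g, hg, rfl⟩ := hx
    exact ⟨1, by simp, g, hg, by simp⟩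
  | zero => exact ⟨1, by simp, 0, F.zero_mem, by simp⟩
  | add x y _ _ hx hy =>
    obtain ⟨s, hs, g, hg, hsg⟩ := hx
    obtain ⟨t, ht, h, hh, hth⟩ := hy
    refine ⟨s * t, by rw [map_mul]; exact mul_ne_zero hs ht, t • g + s • h,
      F.add_mem (F.smul_mem _ hg) (F.smul_mem _ hh), ?_⟩
    rw [map_add, map_smul, map_smul, ← hsg, ← hth, ← algebraMap_smul p.asIdeal.ResidueField t,
      ← algebraMap_smul p.asIdeal.ResidueField s, map_mul]
    module
  | smul a x _ hx =>
    obtain ⟨s, hs, g, hg, hsg⟩ := hx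
    obtain ⟨c, t, ht, htc⟩ := isFractionFieldOfImage_residueField p a
    refine ⟨s * t, by rw [map_mul]; exact mul_ne_zero hs ht, c • g, F.smul_mem _ hg, ?_⟩
    rw [map_smul, ← hsg, ← algebraMap_smul p.asIdeal.ResidueField c, ← htc, map_mul]
    module

/-- Each element of the fibre span is, up to a nonzero scalar, the image of an element of F, and
rescaling the entries of a column preserves surjectivity. -/
theorem le_partialAt_iff_hasSurjection [Module.Finite R N] (p : PrimeSpectrum R)
    (F : Submodule R (M →ₗ[Sᵐᵒᵖ] N)) (d : ℕ) :
    (d : ℕ∞) ≤ partialAt p F ↔ HasSurjection (residueSpan p F) d := by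
  constructor
  · intro h
    by_contra hd
    cases d with
    | zero => exact hd (HasSurjection.zero _)
    | succ d =>
      have hle : partialAt p F ≤ d := by
        refine iSup₂_le fun e he => ?_
        obtain ⟨g, hgF, hg⟩ := he
        rw [locSurjective_iff_surjective_residueMap] at hg
        by_contra! hlt
        refine hd (HasSurjection.mono (d := e) le_rfl (by exact_mod_cast hlt)
          ⟨_, fun i => Submodule.subset_span ⟨g i, hgF i, rfl⟩, hg⟩)
      have := h.trans hle
      norm_cast at this
      omega
  · rintro ⟨u, hu, hsurj⟩
    choose s hs g hg hsg using fun i => exists_smul_eq_residueMap p (hu i)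
    refine le_iSup₂_of_le d ⟨g, hg, ?_⟩ le_rfl
    rw [locSurjective_iff_surjective_residueMap]
    intro y
    obtain ⟨x, hx⟩ := hsurj fun i => (algebraMap R p.asIdeal.ResidueField (s i))⁻¹ • y i
    refine ⟨x, funext fun i => ?_⟩
    have h1 : u i x = _ := congrFun hx i
    simp only [LinearMap.pi_apply, ← hsg, LinearMap.smul_apply, h1]
    exact smul_inv_smul₀ (hs i) _

theorem residueSpan_span_range (p : PrimeSpectrum R) {ι : Type*} (f : ι → (M →ₗ[Sᵐᵒᵖ] N)) :
    residueSpan p (Submodule.span R (Set.range f)) =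
      Submodule.span p.asIdeal.ResidueField (Set.range fun i => residueMap p (f i)) := by
  refine le_antisymm (Submodule.span_le.2 ?_) (Submodule.span_mono ?_)
  · rintro _ ⟨g, hg, rfl⟩
    change g ∈ ((Submodule.span p.asIdeal.ResidueField
      (Set.range fun i => residueMap p (f i))).restrictScalars R).comap (residueMap p)
    refine Submodule.span_le.2 ?_ hg
    rintro _ ⟨i, rfl⟩
    exact Submodule.subset_span ⟨i, rfl⟩
  · rintro _ ⟨i, rfl⟩
    exact ⟨f i, Submodule.subset_span ⟨i, rfl⟩, rfl⟩

theorem isOpen_setOf_le_partialAt [Module.Finite R N] (F : Submodule R (M →ₗ[Sᵐᵒᵖ] N)) (d : ℕ) :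
    IsOpen {p : PrimeSpectrum R | (d : ℕ∞) ≤ partialAt p F} := by
  have h : {p : PrimeSpectrum R | (d : ℕ∞) ≤ partialAt p F} =
      ⋃ e : {e : ℕ // d ≤ e}, ⋃ g : {g : Fin e → (M →ₗ[Sᵐᵒᵖ] N) // ∀ i, g i ∈ F},
        {p : PrimeSpectrum R | LocSurjective p g.1} := by
    ext p
    simp only [Set.mem_ofPred_eq, Set.mem_iUnion]
    constructor
    · intro h
      by_contra! hne
      cases d with
      | zero => exact hne ⟨0, le_rfl⟩ ⟨Fin.elim0, fun i => i.elim0⟩ (by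
          rw [locSurjective_iff_surjective_residueMap]
          exact fun _ => ⟨0, Subsingleton.elim _ _⟩)
      | succ d =>
        have hle : partialAt p F ≤ d := by
          refine iSup₂_le fun e he => ?_
          obtain ⟨g, hgF, hg⟩ := he
          by_contra! hlt
          exact hne ⟨e, by exact_mod_cast hlt⟩ ⟨g, hgF⟩ hg
        have := h.trans hle
        norm_cast at this
        omega
    · rintro ⟨e, g, hg⟩
      exact le_iSup₂_of_le e.1 ⟨g.1, g.2, hg⟩ (by exact_mod_cast e.2)
  rw [h]
  exact isOpen_iUnion fun e => isOpen_iUnion fun g => isOpen_setOf_locSurjective g.1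

end Modules

/-! ### Dimension and minimal members in basic sets -/

section Dimension

variable {R : Type*} [CommRing R]

/-- Taking closures embeds the irreducible closed subsets of Var(p) ∩ X strictly monotonically into
those of Var(q) ∩ X. All images lie in Var(p), so they miss q and sit strictly below the whole
space, which is irreducible with generic point q. An adjoined top is sent to that whole space. -/
theorem dimAt_add_one_le {X : Set (PrimeSpectrum R)} {p q : PrimeSpectrum R} (hqX : q ∈ X)
    (hqp : q < p) : dimAt X p + 1 ≤ dimAt X q := by
  let P : Set (PrimeSpectrum R) := {r | p.asIdeal ≤ r.asIdeal} ∩ X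
  let Q : Set (PrimeSpectrum R) := {r | q.asIdeal ≤ r.asIdeal} ∩ X
  have hPQ : P ⊆ Q := fun r hr => ⟨hqp.le.trans hr.1, hr.2⟩
  let ι : P → Q := Set.inclusion hPQ
  have hι : Topology.IsInducing ι := .of_comp (continuous_inclusion hPQ)
    continuous_subtype_val Topology.IsInducing.subtypeVal
  let q' : Q := ⟨q, le_refl q.asIdeal, hqX⟩
  have htop : closure {q'} = Set.univ := by
    refine Set.eq_univ_of_forall fun r => ?_
    rw [Topology.IsInducing.subtypeVal.closure_eq_preimage_closure_image, Set.image_singleton]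
    exact (PrimeSpectrum.le_iff_mem_closure q r.1).1 r.2.1
  let T : TopologicalSpace.IrreducibleCloseds Q :=
    ⟨Set.univ, htop ▸ isIrreducible_singleton.closure, isClosed_univ⟩
  have hlt : ∀ Z : TopologicalSpace.IrreducibleCloseds P,
      TopologicalSpace.IrreducibleCloseds.map ι hι.continuous Z < T := by
    intro Z
    refine lt_of_le_of_ne (fun _ _ => Set.mem_univ _) fun h => ?_
    have hcl : closure (ι '' (Z : Set P)) = Set.univ :=
      congrArg (fun W : TopologicalSpace.IrreducibleCloseds Q => (W : Set Q)) h
    have hsub : closure (ι '' (Z : Set P)) ⊆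
        (Subtype.val : Q → PrimeSpectrum R) ⁻¹' PrimeSpectrum.zeroLocus p.asIdeal := by
      refine closure_minimal ?_ ((PrimeSpectrum.isClosed_zeroLocus _).preimage
        continuous_subtype_val)
      rintro _ ⟨r, -, rfl⟩
      exact r.2.1
    have hq' : q' ∈ closure (ι '' (Z : Set P)) := hcl ▸ Set.mem_univ _
    exact hqp.not_ge (hsub hq')
  change Order.krullDim _ + 1 ≤ Order.krullDim _
  by_cases hne : Nonempty (TopologicalSpace.IrreducibleCloseds P)
  · rw [← Order.krullDim_WithTop]
    refine Order.krullDim_le_of_strictMono (fun W : WithTop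
      (TopologicalSpace.IrreducibleCloseds P) => W.recTopCoe T
        (TopologicalSpace.IrreducibleCloseds.map ι hι.continuous)) ?_
    intro V W hVW
    induction V using WithTop.recTopCoe with
    | top => exact absurd hVW not_top_lt
    | coe V =>
      induction W using WithTop.recTopCoe with
      | top => exact hlt V
      | coe W =>
        exact TopologicalSpace.IrreducibleCloseds.map_strictMono_of_isInducing hι
          (WithTop.coe_lt_coe.1 hVW)
  -- If Var(p) ∩ X is empty, its dimension is ⊥, and ⊥ + 1 = ⊥.
  · rw [not_nonempty_iff] at hne
    change Order.krullDim (TopologicalSpace.IrreducibleCloseds P) + 1 ≤ _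
    rw [Order.krullDim_eq_bot]
    simp

theorem dimAt_nonneg {X : Set (PrimeSpectrum R)} {p : PrimeSpectrum R} (hp : p ∈ X) :
    0 ≤ dimAt X p := by
  have : Nonempty (TopologicalSpace.IrreducibleCloseds
      ↥({q : PrimeSpectrum R | p.asIdeal ≤ q.asIdeal} ∩ X)) :=
    ⟨⟨closure {⟨p, le_refl p.asIdeal, hp⟩}, isIrreducible_singleton.closure, isClosed_closure⟩⟩
  exact Order.krullDim_nonneg

/-- A relatively closed subset of a basic set has finitely many minimal members. -/
theorem IsBasicSet.finite_minimal {X C : Set (PrimeSpectrum R)} (hX : IsBasicSet X)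
    (hC : IsClosed C) : {p | Minimal (· ∈ X ∩ C) p}.Finite := by
  have := hX.noetherian
  obtain ⟨S, hfin, -, hirr, hS⟩ :=
    TopologicalSpace.NoetherianSpace.exists_finite_set_isClosed_irreducible
      (hC.preimage (continuous_subtype_val (p := (· ∈ X))))
  -- The vanishing ideal of an irreducible Z is prime and is an intersection of members of X, so it
  -- belongs to X; it lies in C because C is closed. Each minimal member of X ∩ C is therefore one
  -- of these finitely many primes.
  have hgen : ∀ Z ∈ S, ∃ q ∈ X ∩ C, ∀ p ∈ Z, q ≤ p.1 := by
    intro Z hZ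
    have hZ' : IsIrreducible (Subtype.val '' Z : Set (PrimeSpectrum R)) :=
      (hirr Z hZ).image _ continuous_subtype_val.continuousOn
    have hprime := PrimeSpectrum.isIrreducible_iff_vanishingIdeal_isPrime.1 hZ'
    have hZC : Subtype.val '' Z ⊆ C := by
      rintro _ ⟨p, hp, rfl⟩
      have : p ∈ ⋃₀ S := ⟨Z, hZ, hp⟩
      rw [← hS] at this
      exact this
    refine ⟨⟨_, hprime⟩, ⟨hX.mem_of_eq_iInf _ ⟨Subtype.val '' Z, ?_, rfl⟩, ?_⟩, ?_⟩
    · rintro _ ⟨p, -, rfl⟩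
      exact p.2
    · refine closure_minimal hZC hC ?_
      rw [← PrimeSpectrum.zeroLocus_vanishingIdeal_eq_closure]
      exact le_rfl (a := PrimeSpectrum.vanishingIdeal (Subtype.val '' Z))
    · intro p hp
      exact fun r hr => (PrimeSpectrum.mem_vanishingIdeal _ _).1 hr _ ⟨p, hp, rfl⟩
  choose γ hγ hγle using fun Z : S => hgen Z.1 Z.2
  have := hfin.to_subtype
  refine (Set.finite_range γ).subset fun p hp => ?_
  obtain ⟨Z, hZ, hpZ⟩ : (⟨p, hp.1.1⟩ : X) ∈ ⋃₀ S := by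
    rw [← hS]
    exact hp.1.2
  have h1 : γ ⟨Z, hZ⟩ ≤ p := hγle ⟨Z, hZ⟩ _ hpZ
  exact ⟨⟨Z, hZ⟩, le_antisymm h1 (hp.2 (hγ ⟨Z, hZ⟩) h1)⟩

end Dimension

/-! ### Elementary operations at finitely many primes -/

section Modules

variable {R S M N : Type*} [CommRing R] [Ring S] [Algebra R S]
  [AddCommGroup M] [Module R M] [Module Sᵐᵒᵖ M] [IsScalarTower R Sᵐᵒᵖ M]
  [AddCommGroup N] [Module R N] [Module Sᵐᵒᵖ N] [IsScalarTower R Sᵐᵒᵖ N]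

/-- By minimality every other q in P has an element outside p; the product of these elements works
because p is prime. -/
theorem exists_forall_mem_notMem_of_minimal (P : Finset (PrimeSpectrum R)) {p : PrimeSpectrum R}
    (hp : Minimal (· ∈ P) p) :
    ∃ s ∉ p.asIdeal, ∀ q ∈ P, q ≠ p → s ∈ q.asIdeal := by
  classical
  choose! s hs hsp using fun q (hq : q ∈ P ∧ q ≠ p) =>
    Set.not_subset.1 (fun h : (q.asIdeal : Set R) ⊆ p.asIdeal =>
      hq.2 (le_antisymm h (hp.2 hq.1 h)))
  refine ⟨∏ q ∈ P.erase p, s q, fun h => ?_, fun q hq hqp => ?_⟩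
  · obtain ⟨q, hq, hsq⟩ := (Ideal.IsPrime.prod_mem_iff (hp := p.2)).1 h
    exact hsp q ⟨Finset.mem_of_mem_erase hq, Finset.ne_of_mem_erase hq⟩ hsq
  · exact Ideal.mem_of_dvd _ (Finset.dvd_prod_of_mem s (Finset.mem_erase.2 ⟨hqp, hq⟩))
      (hs q ⟨hq, hqp⟩)

/-- By operations that do not change the span, the first `n` members of a family of length `n + 1`
can be made to span as many jointly surjective homomorphisms as possible at finitely many
primes. -/
theorem exists_span_eq_and_le_partialAt [Module.Finite R N] {n : ℕ}
    (f : Fin (n + 1) → (M →ₗ[Sᵐᵒᵖ] N)) (P : Finset (PrimeSpectrum R)) :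
    ∃ g : Fin (n + 1) → (M →ₗ[Sᵐᵒᵖ] N),
      Submodule.span R (Set.range g) = Submodule.span R (Set.range f) ∧
      ∀ p ∈ P, min (n : ℕ∞) (partialAt p (Submodule.span R (Set.range f))) ≤
        partialAt p (Submodule.span R (Set.range fun i : Fin n => g i.castSucc)) := by
  classical
  induction P using Finset.strongInduction with
  | H P ih =>
  rcases P.eq_empty_or_nonempty with rfl | hne
  · exact ⟨f, rfl, by simp⟩
  -- A minimal p is treated after all the others, so that a multiplier s can vanish at them without
  -- vanishing at p.
  obtain ⟨p, hp⟩ := P.exists_minimal hne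
  obtain ⟨g, hgf, hg⟩ := ih (P.erase p) (Finset.erase_ssubset hp.1)
  obtain ⟨s, hsp, hs⟩ := exists_forall_mem_notMem_of_minimal P hp
  obtain ⟨k, hk⟩ : ∃ k : ℕ,
      (k : ℕ∞) = min (n : ℕ∞) (partialAt p (Submodule.span R (Set.range f))) :=
    ENat.ne_top_iff_exists.1 (ne_top_of_le_ne_top (ENat.natCast_ne_top n) (min_le_left _ _))
  have hkn : k ≤ n := by
    have : (k : ℕ∞) ≤ n := hk ▸ min_le_left _ _
    exact_mod_cast this
  have hkf : (k : ℕ∞) ≤ partialAt p (Submodule.span R (Set.range g)) :=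
    hgf ▸ hk ▸ min_le_right _ _
  rw [le_partialAt_iff_hasSurjection, residueSpan_span_range] at hkf
  have hs0 : algebraMap R p.asIdeal.ResidueField s ≠ 0 := by
    rwa [Ne, Ideal.algebraMap_residueField_eq_zero]
  obtain ⟨c, r, hcr⟩ := HasSurjection.exists_elementary
    (isFractionFieldOfImage_residueField p) hkn (fun i => residueMap p (g i)) hkf s hs0
  let v : M →ₗ[Sᵐᵒᵖ] N := g (Fin.last n) + ∑ j, (s * c j) • g j.castSucc
  let u : Fin n → (M →ₗ[Sᵐᵒᵖ] N) := fun i => g i.castSucc + (s * r i) • v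
  have hu : ∀ i, Fin.snoc (α := fun _ => M →ₗ[Sᵐᵒᵖ] N) u v (Fin.castSucc i) = u i :=
    fun i => Fin.snoc_castSucc _ _ _
  refine ⟨Fin.snoc (α := fun _ => M →ₗ[Sᵐᵒᵖ] N) u v, ?_, ?_⟩
  · rw [← hgf]
    refine le_antisymm (Submodule.span_le.2 ?_) (Submodule.span_le.2 ?_)
    · have hgm : ∀ i, g i ∈ Submodule.span R (Set.range g) :=
        fun i => Submodule.subset_span ⟨i, rfl⟩
      have hv : v ∈ Submodule.span R (Set.range g) :=
        add_mem (hgm _) (Submodule.sum_mem _ fun j _ => Submodule.smul_mem _ _ (hgm _))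
      rintro _ ⟨i, rfl⟩
      induction i using Fin.lastCases with
      | last => simpa using hv
      | cast i =>
        rw [hu]
        exact add_mem (hgm _) (Submodule.smul_mem _ _ hv)
    · set W := Submodule.span R (Set.range (Fin.snoc (α := fun _ => M →ₗ[Sᵐᵒᵖ] N) u v)) with hW
      have hv : v ∈ W := Submodule.subset_span ⟨Fin.last n, by simp⟩
      have hg' : ∀ i : Fin n, g i.castSucc ∈ W := fun i => by
        have h1 : u i ∈ W := Submodule.subset_span ⟨i.castSucc, hu i⟩
        have h2 := sub_mem h1 (W.smul_mem (s * r i) hv)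
        simpa [u] using h2
      rintro _ ⟨i, rfl⟩
      induction i using Fin.lastCases with
      | last =>
        have h3 := sub_mem hv (W.sum_mem fun j (_ : j ∈ Finset.univ) =>
          W.smul_mem (s * c j) (hg' j))
        simpa [v] using h3
      | cast i => exact hg' i
  · intro q hq
    simp only [hu]
    by_cases hqp : q = p
    · subst hqp
      rw [← hk, le_partialAt_iff_hasSurjection, residueSpan_span_range]
      convert hcr using 4 with i
      simp [u, v, map_add, map_sum, map_smul, -map_mul, algebraMap_smul]
    -- Modulo q the multiplier s is zero, so the first n maps are unchanged on this fibre and the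
    -- inductive bound persists.
    · have h0 : algebraMap R q.asIdeal.ResidueField s = 0 :=
        Ideal.algebraMap_residueField_eq_zero.2 (hs q hq hqp)
      have hres : (fun i => residueMap q (u i)) = fun i : Fin n => residueMap q (g i.castSucc) := by
        funext i
        rw [map_add, map_smul, ← algebraMap_smul q.asIdeal.ResidueField, map_mul, h0, zero_mul,
          zero_smul, add_zero]
      refine (hg q (Finset.mem_erase.2 ⟨hqp, hq⟩)).trans ?_
      refine ENat.forall_natCast_le_iff_le.1 fun d hd => ?_
      rw [le_partialAt_iff_hasSurjection, residueSpan_span_range] at hd ⊢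
      rwa [hres]

/-- On the fibre, omitting one generator leaves a subspace of corank at most one. -/
theorem le_partialAt_of_succ_le [Module.Finite R N] {n d : ℕ} (p : PrimeSpectrum R)
    (f : Fin (n + 1) → (M →ₗ[Sᵐᵒᵖ] N))
    (h : ((d + 1 : ℕ) : ℕ∞) ≤ partialAt p (Submodule.span R (Set.range f))) :
    (d : ℕ∞) ≤ partialAt p (Submodule.span R (Set.range fun i : Fin n => f i.castSucc)) := by
  rw [le_partialAt_iff_hasSurjection, residueSpan_span_range] at h ⊢
  refine HasSurjection.of_corank_one (residueMap p (f (Fin.last n))) ?_ h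
  intro g hg
  rw [Submodule.mem_span_range_iff_exists_fun] at hg
  obtain ⟨a, ha⟩ := hg
  refine ⟨a (Fin.last n), ∑ i : Fin n, a i.castSucc • residueMap p (f i.castSucc), ?_, ?_⟩
  · exact Submodule.sum_mem _ fun i _ => Submodule.smul_mem _ _ (Submodule.subset_span ⟨i, rfl⟩)
  · rw [← ha, Fin.sum_univ_castSucc]

end Modules

end SurjLemma

/-! ### The Surjective Lemma -/

theorem mainTheorem5 {R S M N : Type*} [CommRing R] [Ring S] [Algebra R S] [Module.Finite R S]
    [AddCommGroup M] [Module R M] [Module Sᵐᵒᵖ M] [IsScalarTower R Sᵐᵒᵖ M]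
    [AddCommGroup N] [Module R N] [Module Sᵐᵒᵖ N] [IsScalarTower R Sᵐᵒᵖ N]
    [Module.Finite Sᵐᵒᵖ N]
    (n t : ℕ) (ht : 0 < t) (hn : t + 1 ≤ n)
    (X : Set (PrimeSpectrum R)) (hXN : X ⊆ Module.support R N) (hX : SurjLemma.IsBasicSet X)
    (f : Fin n → (M →ₗ[Sᵐᵒᵖ] N)) (hf : SurjLemma.IsSurjectiveOn t X X f) :
    ∃ f' : Fin (n - 1) → (M →ₗ[Sᵐᵒᵖ] N),
      (∀ i, f' i ∈ Submodule.span R (Set.range f)) ∧ SurjLemma.IsSurjectiveOn t X X f' := by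
  open SurjLemma in
  obtain ⟨n, rfl⟩ : ∃ m, n = m + 1 := ⟨n - 1, by omega⟩
  have : Module.Finite R Sᵐᵒᵖ := Module.Finite.equiv (MulOpposite.opLinearEquiv R)
  have : Module.Finite R N := Module.Finite.trans Sᵐᵒᵖ N
  set F := Submodule.span R (Set.range f) with hF
  let C : ℕ → Set (PrimeSpectrum R) := fun k => {p | ((k + 1 : ℕ) : ℕ∞) ≤ partialAt p F}ᶜ
  have hC : ∀ k, IsClosed (C k) := fun k => (isOpen_setOf_le_partialAt F (k + 1)).isClosed_compl
  have hmemC : ∀ k p, p ∈ C k ↔ partialAt p F ≤ k := fun k p => by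
    rw [Set.mem_compl_iff, Set.mem_ofPred_eq, not_le, Nat.cast_add_one,
      ENat.lt_add_one_iff (ENat.natCast_ne_top k)]
  -- Here n is the new length. Values k ≤ n suffice: where the invariant is at least n + 1, losing
  -- one still leaves n.
  have hfin : (⋃ k ∈ Finset.range (n + 1), {p | Minimal (· ∈ X ∩ C k) p}).Finite :=
    (Finset.range (n + 1)).finite_toSet.biUnion fun k _ => hX.finite_minimal (hC k)
  obtain ⟨g, hgf, hg⟩ := exists_span_eq_and_le_partialAt f hfin.toFinset
  refine ⟨fun i => g i.castSucc, fun i => ?_, fun p hp => ?_⟩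
  · rw [hF, ← hgf]
    exact Submodule.subset_span ⟨i.castSucc, rfl⟩
  set F' := Submodule.span R (Set.range fun i : Fin n => g i.castSucc) with hF'
  change min ((n : ℕ) : WithBot ℕ∞) _ ≤ (partialAt p F' : WithBot ℕ∞)
  have hdrop : ∀ d : ℕ, ((d + 1 : ℕ) : ℕ∞) ≤ partialAt p F → (d : ℕ∞) ≤ partialAt p F' :=
    fun d hd => le_partialAt_of_succ_le p g (by rwa [hgf])
  have hfp : min (((n + 1 : ℕ) : ℕ) : WithBot ℕ∞) (t + dimAt X p) ≤
    (partialAt p F : WithBot ℕ∞) := hf p hp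
  by_cases hle : ((n + 1 : ℕ) : ℕ∞) ≤ partialAt p F
  · exact (min_le_left _ _).trans (by exact_mod_cast hdrop n hle)
  obtain ⟨k, hk⟩ : ∃ k : ℕ, (k : ℕ∞) = partialAt p F :=
    ENat.ne_top_iff_exists.1 fun h => hle (h ▸ le_top)
  have hkn : k < n + 1 := by
    rw [← hk] at hle
    exact_mod_cast not_le.1 hle
  have hpk : p ∈ X ∩ C k := ⟨hp, (hmemC k p).2 hk.ge⟩
  by_cases hmin : Minimal (· ∈ X ∩ C k) p
  · have h1 := hg p (hfin.mem_toFinset.2 (Set.mem_biUnion (Finset.mem_range.2 hkn) hmin))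
    have h2 : min (n : WithBot ℕ∞) (partialAt p F : WithBot ℕ∞) ≤
      (partialAt p F' : WithBot ℕ∞) := by exact_mod_cast h1
    refine le_trans (le_min (min_le_left _ _) (le_trans (le_min ?_ (min_le_right _ _)) hfp)) h2
    exact (min_le_left _ _).trans (by exact_mod_cast Nat.le_succ n)
  · obtain ⟨q, hq, hqp⟩ := (not_minimal_iff_exists_lt hpk).1 hmin
    have hfq : min (((n + 1 : ℕ) : ℕ) : WithBot ℕ∞) (t + dimAt X q) ≤
      (partialAt q F : WithBot ℕ∞) := hf q hqp.1
    have hqk : (partialAt q F : WithBot ℕ∞) ≤ ((k : ℕ∞) : WithBot ℕ∞) :=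
      WithBot.coe_le_coe.2 ((hmemC k q).1 hqp.2)
    -- The minimum at q cannot be n + 1, since it is at most k ≤ n.
    have h1 : (t + dimAt X q : WithBot ℕ∞) ≤ ((k : ℕ∞) : WithBot ℕ∞) := by
      refine (min_le_iff.1 (hfq.trans hqk)).resolve_left fun h => ?_
      have : n + 1 ≤ k := by exact_mod_cast h
      omega
    have h2 : (t + dimAt X p + 1 : WithBot ℕ∞) ≤ ((k : ℕ∞) : WithBot ℕ∞) := by
      rw [add_assoc]
      exact (add_le_add le_rfl (dimAt_add_one_le hqp.1 hq)).trans h1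
    obtain ⟨D, hD⟩ : ∃ D : ℕ∞, (D : WithBot ℕ∞) = dimAt X p :=
      WithBot.ne_bot_iff_exists.1 fun h => by simpa [h] using dimAt_nonneg hp
    rw [← hD] at h2 ⊢
    have h3 : (t : ℕ∞) + D + 1 ≤ k := by exact_mod_cast h2
    cases k with
    | zero => simp at h3
    -- From here the invariant at p is k + 1, so k survives the omission, and t + D ≤ k is what is
    -- required.
    | succ k =>
      have h4 : (t : ℕ∞) + D ≤ k := by
        rw [Nat.cast_add_one] at h3
        exact (ENat.add_le_add_iff_right ENat.one_ne_top).1 h3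
      exact (min_le_right _ _).trans (by exact_mod_cast h4.trans (hdrop k hk.le))
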